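/- Let $(\Omega,\mathcal F,(\mathcal F_t)_{t\in[0,\infty)},P)$ be a filtered probability space satisfying the usual conditions (completeness and right-continuity), and let $X=(X_t)_{t\in[0,\infty)}$ be an adapted $\mathbb R^D$-valued process whose paths are ($P$-almost surely) right-continuous. Suppose that there is a probability measure $Q$ equivalent to $P$ such that $X$ is a $Q$-local martingale. A simple strategy is a process $\Phi_t=\phi_0\mathbf 1_{\{0\}}(t)+\sum_{j=0}^{n-1}\phi_j\mathbf 1_{(\tau_j,\tau_{j+1}]}(t)$, where $n\ge 1$, $0=\tau_0\le\tau_1\le\dots\le\tau_n$ are $P$-a.s. finite (not necessarily bounded) stopping times and each $\phi_j$ is an $\mathcal F_{\tau_j}$-measurable $D$-dimensional random row vector. Its wealth process with zero initial capital is $V_t(\Phi;0)=\sum_{j=0}^{n-1}\Phi_{\tau_{j+1}}(X_{t\wedge\tau_{j+1}}-X_{t\wedge\tau_j})$, and $V_\infty(\Phi;0)=\lim_{t\to\infty}V_t(\Phi;0)=\sum_{j=0}^{n-1}\Phi_{\tau_{j+1}}(X_{\tau_{j+1}}-X_{\tau_j})$ $P$-a.s. It is a simple arbitrage if $V_\infty(\Phi;0)\ge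 0$ $P$-a.s. and $P(V_\infty(\Phi;0)>0)>0$. Then the following assertions are equivalent: (i) $X$ has no simple arbitrage. (ii) $X$ satisfies no obvious arbitrage (NOA): for every stopping time $\sigma$ with values in $[0,\infty]$ and $P(\sigma<\infty)>0$, every $\varepsilon>0$, and every $\mathcal F_\sigma$-measurable $D$-dimensional random row vector $H$ with Euclidean norm $|H|=1$ $P$-a.s., $$P\Bigl(\{\sigma<\infty\}\cap\Bigl\{\sup_{t\in[\sigma,\infty)}H(X_t-X_\sigma)<\varepsilon\Bigr\}\Bigr)>0 .$$ -/

import Mathlib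

open MeasureTheory ProbabilityTheory Filter Topology
open scoped NNReal

namespace SimpleArbitrage

noncomputable section

/-- The usual conditions on `(Ω, 𝓜, 𝓕, P)`: the time-zero σ-algebra contains every subset of a
`P`-null set (so that in particular `P` is complete; `P s` is the outer measure of `s`),
and the filtration is right-continuous. -/
structure UsualConditions {Ω : Type*} [mΩ : MeasurableSpace Ω] (𝓕 : Filtration ℝ≥0 mΩ)
    (P : Measure Ω) : Prop where
  complete : ∀ s : Set Ω, P s = 0 → MeasurableSet[𝓕 0] s
  rightContinuous : 𝓕.IsRightContinuous

/-- `X` is a local martingale: there are stopping times increasing a.s. to infinity such that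
each stopped process `(X_{t ∧ τₙ} 1_{τₙ > 0})_t` is a martingale. -/
def IsLocalMartingale {Ω : Type*} [mΩ : MeasurableSpace Ω] {D : ℕ}
    (X : ℝ≥0 → Ω → EuclideanSpace ℝ (Fin D)) (𝓕 : Filtration ℝ≥0 mΩ) (Q : Measure Ω) : Prop :=
  Locally (fun Y => Martingale Y 𝓕 Q) 𝓕 X Q

/-- The data of a simple strategy
`Φ = φ₀ 1_{{0}} + ∑_{j < n} φⱼ 1_{(τⱼ, τⱼ₊₁]}` in a market with `D` stocks: a.s. finite stopping
times `0 = τ₀ ≤ τ₁ ≤ ⋯ ≤ τₙ`, and `𝓕_{τⱼ}`-measurable random vectors `φⱼ`. -/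
structure SimpleStrategy {Ω : Type*} [mΩ : MeasurableSpace Ω] (𝓕 : Filtration ℝ≥0 mΩ)
    (P : Measure Ω) (D : ℕ) where
  n : ℕ
  n_pos : 0 < n
  τ : Fin (n + 1) → Ω → WithTop ℝ≥0
  φ : Fin n → Ω → EuclideanSpace ℝ (Fin D)
  isStoppingTime : ∀ j, IsStoppingTime 𝓕 (τ j)
  τ_zero : ∀ ω, τ 0 ω = 0
  monotone_τ : ∀ ω, Monotone fun j => τ j ω
  finite_τ : ∀ j, ∀ᵐ ω ∂P, τ j ω < ⊤
  measurable_φ : ∀ j : Fin n, Measurable[(isStoppingTime j.castSucc).measurableSpace] (φ j)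

namespace SimpleStrategy

variable {Ω : Type*} [mΩ : MeasurableSpace Ω] {𝓕 : Filtration ℝ≥0 mΩ} {P : Measure Ω} {D : ℕ}

/-- The number of shares held at time `t`:
`Φ_t = φ₀ 1_{{0}}(t) + ∑_{j < n} φⱼ 1_{(τⱼ, τⱼ₊₁]}(t)`. -/
def holding (Φ : SimpleStrategy 𝓕 P D) (t : ℝ≥0) (ω : Ω) : EuclideanSpace ℝ (Fin D) :=
  Set.indicator {0} (fun _ => Φ.φ ⟨0, Φ.n_pos⟩ ω) t +
    ∑ j : Fin Φ.n, Set.indicator {s : ℝ≥0 | Φ.τ j.castSucc ω < s ∧ s ≤ Φ.τ j.succ ω}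
      (fun _ => Φ.φ j ω) t

/-- The self-financing wealth process with initial capital `v`:
`V_t(Φ; v) = v + ∑_{j < n} Φ_{τⱼ₊₁} (X_{t ∧ τⱼ₊₁} - X_{t ∧ τⱼ})`. -/
def wealth (Φ : SimpleStrategy 𝓕 P D) (X : ℝ≥0 → Ω → EuclideanSpace ℝ (Fin D)) (v : ℝ)
    (t : ℝ≥0) (ω : Ω) : ℝ :=
  v + ∑ j : Fin Φ.n, inner ℝ (stoppedValue Φ.holding (Φ.τ j.succ) ω)
    (stoppedProcess X (Φ.τ j.succ) t ω - stoppedProcess X (Φ.τ j.castSucc) t ω)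

/-- The terminal wealth `V_∞(Φ; v) = v + ∑_{j < n} Φ_{τⱼ₊₁} (X_{τⱼ₊₁} - X_{τⱼ})`. It is the
almost sure limit of `V_t(Φ; v)` as `t → ∞`, see `tendsto_wealth` below. -/
def terminalWealth (Φ : SimpleStrategy 𝓕 P D) (X : ℝ≥0 → Ω → EuclideanSpace ℝ (Fin D)) (v : ℝ)
    (ω : Ω) : ℝ :=
  v + ∑ j : Fin Φ.n, inner ℝ (stoppedValue Φ.holding (Φ.τ j.succ) ω)
    (stoppedValue X (Φ.τ j.succ) ω - stoppedValue X (Φ.τ j.castSucc) ω)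

theorem tendsto_wealth (Φ : SimpleStrategy 𝓕 P D) (X : ℝ≥0 → Ω → EuclideanSpace ℝ (Fin D))
    (v : ℝ) :
    ∀ᵐ ω ∂P, Tendsto (fun t => Φ.wealth X v t ω) atTop (𝓝 (Φ.terminalWealth X v ω)) := by
  filter_upwards [ae_all_iff.2 Φ.finite_τ] with ω hω
  have key : ∀ j, ∀ᶠ t : ℝ≥0 in atTop,
      stoppedProcess X (Φ.τ j) t ω = stoppedValue X (Φ.τ j) ω := by
    intro j
    obtain ⟨a, ha⟩ := WithTop.ne_top_iff_exists.1 (hω j).ne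
    filter_upwards [eventually_ge_atTop a] with t ht
    have h : min (t : WithTop ℝ≥0) (Φ.τ j ω) = Φ.τ j ω := by
      rw [← ha]
      exact min_eq_right (WithTop.coe_le_coe.2 ht)
    simp only [stoppedProcess, stoppedValue, h]
  refine tendsto_const_nhds.congr' ?_
  filter_upwards [eventually_all.2 key] with t ht
  simp only [wealth, terminalWealth, ht]

/-- A simple strategy is an arbitrage if `V_∞(Φ; 0) ≥ 0` a.s. and `P(V_∞(Φ; 0) > 0) > 0`. -/
def IsArbitrage (Φ : SimpleStrategy 𝓕 P D) (X : ℝ≥0 → Ω → EuclideanSpace ℝ (Fin D)) : Prop :=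
  (∀ᵐ ω ∂P, 0 ≤ Φ.terminalWealth X 0 ω) ∧ 0 < P {ω | 0 < Φ.terminalWealth X 0 ω}

end SimpleStrategy

/-- There is a simple strategy that is an arbitrage. -/
def HasSimpleArbitrage {Ω : Type*} [mΩ : MeasurableSpace Ω] {D : ℕ}
    (X : ℝ≥0 → Ω → EuclideanSpace ℝ (Fin D)) (𝓕 : Filtration ℝ≥0 mΩ) (P : Measure Ω) : Prop :=
  ∃ Φ : SimpleStrategy 𝓕 P D, Φ.IsArbitrage X

/-- No obvious arbitrage (NOA): for every stopping time `σ` with `P(σ < ∞) > 0`, every `ε > 0` and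
every `𝓕_σ`-measurable random vector `H` with Euclidean norm `1` a.s.,
`P({σ < ∞} ∩ {sup_{t ∈ [σ, ∞)} H (X_t - X_σ) < ε}) > 0`. The supremum is taken in the extended
reals, so it is `+∞` when the gains are unbounded. -/
def NoObviousArbitrage {Ω : Type*} [mΩ : MeasurableSpace Ω] {D : ℕ}
    (X : ℝ≥0 → Ω → EuclideanSpace ℝ (Fin D)) (𝓕 : Filtration ℝ≥0 mΩ) (P : Measure Ω) : Prop :=
  ∀ (σ : Ω → WithTop ℝ≥0) (hσ : IsStoppingTime 𝓕 σ) (ε : ℝ), 0 < ε →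
    0 < P {ω | σ ω < ⊤} →
    ∀ H : Ω → EuclideanSpace ℝ (Fin D), Measurable[hσ.measurableSpace] H →
      (∀ᵐ ω ∂P, ‖H ω‖ = 1) →
      0 < P ({ω | σ ω < ⊤} ∩
        {ω | (⨆ (t : ℝ≥0) (_ : σ ω ≤ t),
          ((inner ℝ (H ω) (X t ω - stoppedValue X σ ω) : ℝ) : EReal)) < (ε : EReal)})

end

end SimpleArbitrage

/-! If NOA fails for `σ`, `ε`, `H`, then a.s. on `σ < ∞` the gain of holding `H` from `σ` on exceeds
`ε / 2` at some time. Buying at `σ` and selling when that level is first passed is an arbitrage: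
right-continuity keeps the gain at the selling time at least `ε / 2`
(`noObviousArbitrage_of_not_hasSimpleArbitrage`).

Conversely, a simple arbitrage contains an arbitrage over one period `[σ, τ]`
(`SimpleStrategy.IsArbitrage.exists_singleStep`). NOA makes its gain nonnegative on the whole
period: from a loss of at least some fixed size, the recovery by `τ` would be an obvious arbitrage
(`NoObviousArbitrage.gain_nonneg`). The gains, stopped along a localizing sequence of the `Q`-local
martingale, are then nonnegative with `Q`-mean zero by optional sampling, hence null
(`IsLocalMartingale.gain_eq_zero`). Since `P ≪ Q`, the final gain vanishes `P`-a.s., a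
contradiction. Nonnegativity before `τ` is essential, because localization sees the gain at times
before `τ`. -/

namespace SimpleArbitrage

/-! ### Approximation of stopping times from above -/

/-- The smallest multiple of `1 / (k + 1)` that is strictly larger than `s`. -/
noncomputable def discretize (k : ℕ) (s : ℝ≥0) : ℝ≥0 := (⌊s * (k + 1)⌋₊ + 1) / (k + 1)

theorem lt_discretize (k : ℕ) (s : ℝ≥0) : s < discretize k s := by
  rw [discretize, lt_div_iff₀ (by positivity)]
  exact Nat.lt_floor_add_one _

theorem discretize_le_add (k : ℕ) (s : ℝ≥0) : discretize k s ≤ s + 1 / (k + 1) := by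
  rw [discretize, add_div]
  gcongr
  rw [div_le_iff₀ (by positivity)]
  exact Nat.floor_le (by positivity)

theorem tendsto_discretize (s : ℝ≥0) : Tendsto (fun k => discretize k s) atTop (𝓝 s) := by
  have h : Tendsto (fun k : ℕ => s + 1 / ((k : ℝ≥0) + 1)) atTop (𝓝 s) := by
    simpa using (tendsto_const_nhds (x := s)).add
      (tendsto_one_div_add_atTop_nhds_zero_nat (𝕜 := ℝ≥0))
  exact tendsto_of_tendsto_of_tendsto_of_le_of_le tendsto_const_nhds h
    (fun k => (lt_discretize k s).le) (fun k => discretize_le_add k s)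

theorem discretize_le_iff (k : ℕ) (s i : ℝ≥0) :
    discretize k s ≤ i ↔ s < ⌊i * (k + 1)⌋₊ / (k + 1) := by
  rw [discretize, div_le_iff₀ (by positivity), lt_div_iff₀ (by positivity),
    ← Nat.cast_add_one, ← Nat.le_floor_iff (by positivity), Nat.add_one_le_iff,
    Nat.floor_lt (by positivity)]

section

variable {Ω : Type*} {τ σ : Ω → WithTop ℝ≥0}

/-- Approximation from above of `τ ∧ t` by stopping times with countable range. -/
noncomputable def approxTime (τ : Ω → WithTop ℝ≥0) (t : ℝ≥0) (k : ℕ) (ω : Ω) : WithTop ℝ≥0 :=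
  min ((τ ω).map (discretize k)) t

theorem approxTime_le (τ : Ω → WithTop ℝ≥0) (t : ℝ≥0) (k : ℕ) (ω : Ω) :
    approxTime τ t k ω ≤ t := min_le_right _ _

theorem approxTime_of_coe {t s : ℝ≥0} {ω : Ω} (h : τ ω = s) (k : ℕ) :
    approxTime τ t k ω = (min (discretize k s) t : ℝ≥0) := by
  simp only [approxTime, h, WithTop.map_coe, WithTop.coe_min]

theorem le_approxTime {t : ℝ≥0} (hτ : ∀ ω, τ ω ≤ t) (k : ℕ) : τ ≤ approxTime τ t k := by
  intro ω
  obtain ⟨s, hs⟩ := WithTop.ne_top_iff_exists.1 ((hτ ω).trans_lt (WithTop.coe_lt_top t)).ne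
  have hst : s ≤ t := WithTop.coe_le_coe.1 (hs ▸ hτ ω)
  rw [approxTime_of_coe hs.symm, ← hs]
  exact WithTop.coe_le_coe.2 (le_min (lt_discretize k s).le hst)

theorem countable_range_approxTime (τ : Ω → WithTop ℝ≥0) (t : ℝ≥0) (k : ℕ) :
    (Set.range (approxTime τ t k)).Countable := by
  refine ((Set.countable_range fun m : ℕ =>
    min (((m + 1) / (k + 1) : ℝ≥0) : WithTop ℝ≥0) t).union
      (Set.countable_singleton (t : WithTop ℝ≥0))).mono ?_
  rintro _ ⟨ω, rfl⟩
  cases h : τ ω with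
  | top => right; simp [approxTime, h, -ENNReal.some_eq_coe']
  | coe s => left; exact ⟨⌊s * (k + 1)⌋₊, by simp [approxTime, h, discretize, -ENNReal.some_eq_coe']⟩

theorem tendsto_stoppedValue_approxTime {E : Type*} [TopologicalSpace E] {X : ℝ≥0 → Ω → E}
    {t : ℝ≥0} {ω : Ω} (hX : ∀ t : ℝ≥0, ContinuousWithinAt (fun s => X s ω) (Set.Ici t) t)
    (hτ : τ ω ≤ t) :
    Tendsto (fun k => stoppedValue X (approxTime τ t k) ω) atTop (𝓝 (stoppedValue X τ ω)) := by
  obtain ⟨s, hs⟩ := WithTop.ne_top_iff_exists.1 (hτ.trans_lt (WithTop.coe_lt_top t)).ne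
  have hst : s ≤ t := WithTop.coe_le_coe.1 (hs ▸ hτ)
  simp only [stoppedValue, approxTime_of_coe hs.symm, ← hs, WithTop.untopD_coe]
  refine (hX s).tendsto.comp (tendsto_nhdsWithin_iff.2 ⟨?_, .of_forall fun k => ?_⟩)
  · have := (tendsto_discretize s).min (tendsto_const_nhds (x := t))
    rwa [min_eq_left hst] at this
  · exact le_min (lt_discretize k s).le hst

variable [mΩ : MeasurableSpace Ω] {𝓕 : Filtration ℝ≥0 mΩ} {P : Measure Ω}

theorem isStoppingTime_approxTime (hτ : IsStoppingTime 𝓕 τ) (t : ℝ≥0) (k : ℕ) :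
    IsStoppingTime 𝓕 (approxTime τ t k) := by
  refine IsStoppingTime.min_const (fun i => ?_) t
  have h : {ω | (τ ω).map (discretize k) ≤ i}
      = {ω | τ ω < ((⌊i * (k + 1)⌋₊ / (k + 1) : ℝ≥0) : WithTop ℝ≥0)} := by
    ext ω
    cases h : τ ω with
    | top => simp [h, -ENNReal.some_eq_coe']
    | coe s =>
      simp only [Set.mem_ofPred_eq, h, WithTop.map_coe]
      rw [WithTop.coe_le_coe, WithTop.coe_lt_coe, discretize_le_iff]
  rw [h]
  refine hτ.measurableSet_lt_le ?_
  rw [div_le_iff₀ (by positivity)]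
  exact Nat.floor_le (by positivity)

/-! ### Measurability of stopped values -/

/-- If the time-zero σ-algebra contains all subsets of null sets, `𝓕 t`-measurability is
insensitive to changes on null sets. -/
theorem measurable_of_ae_eq {E : Type*} [MeasurableSpace E]
    (h𝓕 : UsualConditions 𝓕 P) {t : ℝ≥0} {f g : Ω → E} (hg : Measurable[𝓕 t] g)
    (hfg : f =ᵐ[P] g) : Measurable[𝓕 t] f := by
  intro B hB
  have hnull : ∀ s ⊆ {ω | f ω ≠ g ω}, MeasurableSet[𝓕 t] s := fun s hs =>
    𝓕.mono zero_le s (h𝓕.complete s (measure_mono_null hs (ae_iff.1 hfg)))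
  have : f ⁻¹' B = (g ⁻¹' B \ {ω | f ω ≠ g ω}) ∪ (f ⁻¹' B ∩ {ω | f ω ≠ g ω}) := by
    ext ω
    by_cases h : f ω = g ω <;> simp [h]
  rw [this]
  exact ((hg hB).diff (hnull _ subset_rfl)).union (hnull _ Set.inter_subset_right)

theorem measurable_stoppedValue_of_countable_range {E : Type*} [MeasurableSpace E]
    {X : ℝ≥0 → Ω → E} (hX : Adapted 𝓕 X) (hτ : IsStoppingTime 𝓕 τ) {t : ℝ≥0}
    (hτt : ∀ ω, τ ω ≤ t) (hc : (Set.range τ).Countable) :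
    Measurable[𝓕 t] (stoppedValue X τ) := by
  intro B hB
  have : stoppedValue X τ ⁻¹' B =
      ⋃ r ∈ Set.range τ, ({ω | τ ω = r} ∩ X r.untopA ⁻¹' B) := by
    ext ω
    simp only [stoppedValue, Set.mem_preimage, Set.mem_iUnion, Set.mem_inter_iff,
      Set.mem_ofPred_eq, exists_prop]
    exact ⟨fun h => ⟨_, ⟨ω, rfl⟩, rfl, h⟩, fun ⟨_, _, h, h'⟩ => h ▸ h'⟩
  rw [this]
  refine MeasurableSet.biUnion hc ?_
  rintro _ ⟨ω, rfl⟩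
  obtain ⟨s, hs⟩ := WithTop.ne_top_iff_exists.1 ((hτt ω).trans_lt (WithTop.coe_lt_top t)).ne
  have hst : s ≤ t := WithTop.coe_le_coe.1 (hs ▸ hτt ω)
  rw [← hs, WithTop.untopA, WithTop.untopD_coe]
  exact (hτ.measurableSet_eq_le hst).inter (hX.measurable_le hst hB)

/-- Stopped values at the countable-range times `approxTime τ t k ≤ t` are `𝓕 t`-measurable and
converge by right-continuity. The null set of bad paths lies in `𝓕 0`, so it can be cut out first.
-/
theorem measurable_stoppedValue_of_le {E : Type*} [TopologicalSpace E]
    [TopologicalSpace.PseudoMetrizableSpace E] [MeasurableSpace E] [BorelSpace E] [Zero E]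
    (h𝓕 : UsualConditions 𝓕 P) {X : ℝ≥0 → Ω → E} (hX : Adapted 𝓕 X)
    (hrc : ∀ᵐ ω ∂P, ∀ t : ℝ≥0, ContinuousWithinAt (fun s => X s ω) (Set.Ici t) t)
    (hτ : IsStoppingTime 𝓕 τ) {t : ℝ≥0} (hτt : ∀ ω, τ ω ≤ t) :
    Measurable[𝓕 t] (stoppedValue X τ) := by
  set N := {ω | ¬ ∀ t : ℝ≥0, ContinuousWithinAt (fun s => X s ω) (Set.Ici t) t} with hN
  have hNm : MeasurableSet[𝓕 t] N := 𝓕.mono zero_le N (h𝓕.complete N hrc)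
  refine measurable_of_ae_eq h𝓕 (g := Nᶜ.indicator (stoppedValue X τ)) ?_ ?_
  · refine @measurable_of_tendsto_metrizable _ _ (𝓕 t) _ _ _ _
      (fun k => Nᶜ.indicator (stoppedValue X (approxTime τ t k))) _ (fun k => ?_) ?_
    · exact (measurable_stoppedValue_of_countable_range hX (isStoppingTime_approxTime hτ t k)
        (approxTime_le τ t k) (countable_range_approxTime τ t k)).indicator hNm.compl
    · refine tendsto_pi_nhds.2 fun ω => ?_
      by_cases hω : ω ∈ N
      · simpa [hω] using tendsto_const_nhds
      · simp only [Set.indicator_of_mem (Set.mem_compl hω)]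
        exact tendsto_stoppedValue_approxTime (by simpa [hN] using hω) (hτt ω)
  · filter_upwards [hrc] with ω hω
    have : ω ∈ Nᶜ := by simpa [hN] using hω
    rw [Set.indicator_of_mem this]

theorem measurable_stoppedValue_stoppingTime {E : Type*} [TopologicalSpace E]
    [TopologicalSpace.PseudoMetrizableSpace E] [MeasurableSpace E] [BorelSpace E] [Zero E]
    (h𝓕 : UsualConditions 𝓕 P) {X : ℝ≥0 → Ω → E} (hX : Adapted 𝓕 X)
    (hrc : ∀ᵐ ω ∂P, ∀ t : ℝ≥0, ContinuousWithinAt (fun s => X s ω) (Set.Ici t) t)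
    (hτ : IsStoppingTime 𝓕 τ) : Measurable[hτ.measurableSpace] (stoppedValue X τ) := by
  intro B hB
  have key : ∀ i : ℝ≥0, MeasurableSet[𝓕 i] (stoppedValue X τ ⁻¹' B ∩ {ω | τ ω ≤ i}) := by
    intro i
    have : stoppedValue X τ ⁻¹' B ∩ {ω | τ ω ≤ i} =
        stoppedValue X (fun ω => min (τ ω) i) ⁻¹' B ∩ {ω | τ ω ≤ i} := by
      ext ω
      simp only [stoppedValue, Set.mem_inter_iff, Set.mem_preimage, Set.mem_ofPred_eq,
        and_congr_left_iff]
      intro h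
      rw [min_eq_left h]
    rw [this]
    exact ((measurable_stoppedValue_of_le h𝓕 hX hrc (hτ.min_const i)
      fun _ => min_le_right _ _) hB).inter (hτ i)
  refine ⟨?_, key⟩
  -- Where `τ = ⊤`, the stopped value is `X` at the fixed default time `(⊤).untopA`.
  have : stoppedValue X τ ⁻¹' B = (⋃ n : ℕ, stoppedValue X τ ⁻¹' B ∩ {ω | τ ω ≤ (n : ℝ≥0)}) ∪
      (X (⊤ : WithTop ℝ≥0).untopA ⁻¹' B ∩ {ω | τ ω = ⊤}) := by
    ext ω
    cases h : τ ω with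
    | top => simp [stoppedValue, h]
    | coe s =>
      obtain ⟨n, hn⟩ := exists_nat_ge s
      simp only [stoppedValue, h, Set.mem_preimage, Set.mem_union, Set.mem_iUnion,
        Set.mem_inter_iff, Set.mem_ofPred_eq, WithTop.coe_ne_top, and_false, or_false]
      exact ⟨fun hB => ⟨n, hB, mod_cast hn⟩, fun ⟨_, hB, _⟩ => hB⟩
  rw [this]
  exact (MeasurableSet.iUnion fun n : ℕ => le_iSup (fun t => 𝓕 t) (n : ℝ≥0) _ (key n)).union
    ((le_iSup (fun t => 𝓕 t) _ _ (hX _ hB)).inter hτ.measurableSet_eq_top')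

/-- Lets a position opened at `σ` be opened at the bounded time `σ ∧ t` instead, and be zero where
`σ > t`; it rests on `𝓕_{σ ∧ t} = 𝓕_σ ⊓ 𝓕_t`. -/
theorem measurable_indicator_min_const {E : Type*} [MeasurableSpace E] [Zero E]
    (hσ : IsStoppingTime 𝓕 σ) {G : Ω → E} (hG : Measurable[hσ.measurableSpace] G) (t : ℝ≥0) :
    Measurable[(hσ.min_const t).measurableSpace] ({ω | σ ω ≤ t}.indicator G) := by
  have h1 : Measurable[hσ.measurableSpace] ({ω | σ ω ≤ t}.indicator G) :=
    hG.indicator (hσ.measurableSet_le' t)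
  have h2 : Measurable[𝓕 t] ({ω | σ ω ≤ t}.indicator G) := by
    intro B hB
    classical
    rw [Set.indicator_preimage, Set.ite]
    refine ((hG hB).2 t).union (MeasurableSet.diff ?_ (hσ t))
    exact (measurable_const (a := (0 : E))) hB
  rw [hσ.measurableSpace_min_const]
  exact fun B hB => MeasurableSpace.measurableSet_inf.2 ⟨h1 hB, h2 hB⟩

/-! ### Optional sampling -/

/-- Optional sampling at a bounded stopping time for right-continuous martingales. -/
theorem integral_mul_stoppedValue [IsProbabilityMeasure P] {M : ℝ≥0 → Ω → ℝ}
    (hM : Martingale M 𝓕 P)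
    (hrc : ∀ᵐ ω ∂P, ∀ t : ℝ≥0, ContinuousWithinAt (fun s => M s ω) (Set.Ici t) t)
    (hτ : IsStoppingTime 𝓕 τ) {t : ℝ≥0} (hτt : ∀ ω, τ ω ≤ t) :
    Integrable (stoppedValue M τ) P ∧ ∀ (G : Ω → ℝ), Measurable[hτ.measurableSpace] G →
      (∀ ω, |G ω| ≤ 1) → ∫ ω, G ω * stoppedValue M τ ω ∂P = ∫ ω, G ω * M t ω ∂P := by
  set S : ℕ → Ω → ℝ := fun k => stoppedValue M (approxTime τ t k) with hS
  have hst := fun k => isStoppingTime_approxTime hτ t k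
  have hce : ∀ k, S k =ᵐ[P] P[M t | (hst k).measurableSpace] := fun k =>
    hM.stoppedValue_ae_eq_condExp_of_le_const_of_countable_range (hst k)
      (approxTime_le τ t k) (countable_range_approxTime τ t k)
  -- All approximants are conditional expectations of the single variable `M t`; this upgrades a.s.
  -- convergence to `L¹`.
  have hUI : UniformIntegrable S 1 P :=
    ((hM.integrable t).uniformIntegrable_condExp fun k => (hst k).measurableSpace_le).ae_eq
      fun k => (hce k).symm
  have hlim : ∀ᵐ ω ∂P, Tendsto (fun k => S k ω) atTop (𝓝 (stoppedValue M τ ω)) := by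
    filter_upwards [hrc] with ω hω using tendsto_stoppedValue_approxTime hω (hτt ω)
  have hmem : MemLp (stoppedValue M τ) 1 P := hUI.memLp_of_ae_tendsto hlim
  have hint := memLp_one_iff_integrable.1 hmem
  refine ⟨hint, fun G hG hG1 => ?_⟩
  have hL1 := tendsto_Lp_finite_of_tendsto_ae le_rfl ENNReal.one_ne_top hUI.1 hmem hUI.2.1 hlim
  have hGm : AEStronglyMeasurable G P :=
    (hG.mono hτ.measurableSpace_le le_rfl).aestronglyMeasurable
  have hGb : ∀ᵐ ω ∂P, ‖G ω‖ ≤ 1 := .of_forall hG1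
  have hSint : ∀ k, Integrable (S k) P := fun k => memLp_one_iff_integrable.1 (hUI.memLp k)
  have hk : ∀ k, ∫ ω, G ω * S k ω ∂P = ∫ ω, G ω * M t ω ∂P := by
    intro k
    -- Approximation from above matters here: `τ ≤ approxTime τ t k` keeps `G` measurable at each
    -- approximating time.
    have hGk : StronglyMeasurable[(hst k).measurableSpace] G :=
      (hG.mono (hτ.measurableSpace_mono (hst k) (le_approxTime hτt k)) le_rfl).stronglyMeasurable
    have h1 : P[G * M t | (hst k).measurableSpace] =ᵐ[P] G * S k :=
      (condExp_mul_of_stronglyMeasurable_left hGk ((hM.integrable t).bdd_mul hGm hGb)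
        (hM.integrable t)).trans (EventuallyEq.rfl.mul (hce k).symm)
    calc ∫ ω, G ω * S k ω ∂P = ∫ ω, (P[G * M t | (hst k).measurableSpace]) ω ∂P :=
          integral_congr_ae h1.symm
      _ = _ := integral_condExp (hst k).measurableSpace_le
  have ht : Tendsto (fun k => ∫ ω, G ω * S k ω ∂P) atTop
      (𝓝 (∫ ω, G ω * stoppedValue M τ ω ∂P)) := by
    refine tendsto_integral_of_L1' _ (hint.bdd_mul hGm hGb).aestronglyMeasurable
      (.of_forall fun k => (hSint k).bdd_mul hGm hGb) ?_
    refine tendsto_of_tendsto_of_tendsto_of_le_of_le tendsto_const_nhds hL1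
      (fun _ => zero_le) fun k => ?_
    refine eLpNorm_mono fun ω => ?_
    simp only [Pi.sub_apply, ← mul_sub, norm_mul]
    exact mul_le_of_le_one_left (norm_nonneg _) (hG1 ω)
  simp only [hk] at ht
  exact tendsto_nhds_unique ht tendsto_const_nhds

end

section

variable {Ω : Type*} [mΩ : MeasurableSpace Ω] {𝓕 : Filtration ℝ≥0 mΩ} {P : Measure Ω} {D : ℕ}
  {τ σ : Ω → WithTop ℝ≥0} {X : ℝ≥0 → Ω → EuclideanSpace ℝ (Fin D)}

theorem stoppedValue_of_coe {Ω E : Type*} {τ : Ω → WithTop ℝ≥0} {X : ℝ≥0 → Ω → E} {s : ℝ≥0}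
    {ω : Ω} (h : τ ω = s) : stoppedValue X τ ω = X s ω := by
  rw [stoppedValue, h, WithTop.untopA, WithTop.untopD_coe]

theorem martingale_coord {M : ℝ≥0 → Ω → EuclideanSpace ℝ (Fin D)} (hM : Martingale M 𝓕 P)
    (i : Fin D) : Martingale (fun t ω => M t ω i) 𝓕 P := by
  refine ⟨fun t => ?_, fun s t hst => ?_⟩
  · exact (EuclideanSpace.proj (𝕜 := ℝ) i).continuous.comp_stronglyMeasurable (hM.1 t)
  · have h := (EuclideanSpace.proj (𝕜 := ℝ) i).comp_condExp_comm (m := 𝓕 s) (hM.integrable t)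
    filter_upwards [h, hM.2 s t hst] with ω h1 h2
    simp only [Function.comp_apply, h2] at h1
    exact h1.symm

/-- In each coordinate both stopped values may be replaced by `M t` under the integral, because the
weight, known at `σ`, is also known at `τ`. -/
theorem integral_inner_stoppedValue_sub [IsProbabilityMeasure P]
    {M : ℝ≥0 → Ω → EuclideanSpace ℝ (Fin D)} (hM : Martingale M 𝓕 P)
    (hrc : ∀ᵐ ω ∂P, ∀ t : ℝ≥0, ContinuousWithinAt (fun s => M s ω) (Set.Ici t) t)
    (hσ : IsStoppingTime 𝓕 σ) (hτ : IsStoppingTime 𝓕 τ) (hστ : σ ≤ τ) {t : ℝ≥0}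
    (hτt : ∀ ω, τ ω ≤ t) {G : Ω → EuclideanSpace ℝ (Fin D)}
    (hG : Measurable[hσ.measurableSpace] G) (hG1 : ∀ ω, ‖G ω‖ ≤ 1) :
    Integrable (fun ω => inner ℝ (G ω) (stoppedValue M τ ω - stoppedValue M σ ω)) P ∧
      ∫ ω, inner ℝ (G ω) (stoppedValue M τ ω - stoppedValue M σ ω) ∂P = 0 := by
  have hrci : ∀ i : Fin D, ∀ᵐ ω ∂P, ∀ t : ℝ≥0,
      ContinuousWithinAt (fun s => M s ω i) (Set.Ici t) t := by
    intro i
    filter_upwards [hrc] with ω hω t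
    exact (EuclideanSpace.proj (𝕜 := ℝ) i).continuous.continuousAt.comp_continuousWithinAt (hω t)
  have hGi : ∀ i : Fin D, Measurable[hσ.measurableSpace] fun ω => G ω i := fun i =>
    (EuclideanSpace.proj (𝕜 := ℝ) i).continuous.measurable.comp hG
  have hGi1 : ∀ (i : Fin D) ω, |G ω i| ≤ 1 := fun i ω =>
    (PiLp.norm_apply_le (G ω) i).trans (hG1 ω)
  have h1 := fun i => integral_mul_stoppedValue (martingale_coord hM i) (hrci i) hτ hτt
  have h2 := fun i => integral_mul_stoppedValue (martingale_coord hM i) (hrci i) hσ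
    (fun ω => (hστ ω).trans (hτt ω))
  have hexp : ∀ ω, inner ℝ (G ω) (stoppedValue M τ ω - stoppedValue M σ ω) =
      ∑ i, (G ω i * stoppedValue (fun t ω => M t ω i) τ ω
        - G ω i * stoppedValue (fun t ω => M t ω i) σ ω) := by
    intro ω
    rw [PiLp.inner_apply]
    refine Finset.sum_congr rfl fun i _ => ?_
    simp only [stoppedValue, PiLp.sub_apply, RCLike.inner_apply, conj_trivial]
    ring
  have hGm : ∀ i, AEStronglyMeasurable (fun ω => G ω i) P := fun i =>
    ((hGi i).mono hσ.measurableSpace_le le_rfl).aestronglyMeasurable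
  have i1 := fun i => (h1 i).1.bdd_mul (hGm i) (.of_forall (hGi1 i))
  have i2 := fun i => (h2 i).1.bdd_mul (hGm i) (.of_forall (hGi1 i))
  have i3 : ∀ i ∈ Finset.univ, Integrable (fun ω => G ω i * stoppedValue (fun t ω => M t ω i) τ ω
      - G ω i * stoppedValue (fun t ω => M t ω i) σ ω) P := fun i _ => (i1 i).sub (i2 i)
  simp only [hexp]
  refine ⟨integrable_finsetSum _ i3, ?_⟩
  rw [integral_finsetSum _ i3]
  refine Finset.sum_eq_zero fun i _ => ?_
  rw [integral_sub (i1 i) (i2 i), (h2 i).2 _ (hGi i) (hGi1 i), (h1 i).2 _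
    ((hGi i).mono (hσ.measurableSpace_mono hτ hστ) le_rfl) (hGi1 i), sub_self]

theorem continuousWithinAt_stoppedProcess {Ω E : Type*} [TopologicalSpace E]
    {Y : ℝ≥0 → Ω → E} {ρ : Ω → WithTop ℝ≥0} {ω : Ω}
    (hY : ∀ t : ℝ≥0, ContinuousWithinAt (fun s => Y s ω) (Set.Ici t) t) (t : ℝ≥0) :
    ContinuousWithinAt (fun s => stoppedProcess Y ρ s ω) (Set.Ici t) t := by
  cases h : ρ ω with
  | top =>
    have : ∀ s : ℝ≥0, stoppedProcess Y ρ s ω = Y s ω := fun s =>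
      stoppedProcess_eq_of_le (h ▸ le_top)
    simpa only [this] using hY t
  | coe r =>
    have : ∀ s : ℝ≥0, stoppedProcess Y ρ s ω = Y (min s r) ω := by
      intro s
      rw [stoppedProcess, h, ← WithTop.coe_min, WithTop.untopA, WithTop.untopD_coe]
    simp only [this]
    exact (hY (min t r)).comp (t := Set.Ici (min t r)) (f := fun s => min s r)
      (by fun_prop) fun s hs => min_le_min_right r hs

/-! ### Wealth of simple strategies -/

/-- The intervals `(τⱼ, τⱼ₊₁]` are disjoint, so the holding at `τⱼ₊₁` is `φⱼ` unless the interval is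
empty, and then the price increment is zero. -/
theorem SimpleStrategy.terminalWealth_eq_sum (Φ : SimpleStrategy 𝓕 P D) {ω : Ω}
    (hω : ∀ j, Φ.τ j ω < ⊤) :
    Φ.terminalWealth X 0 ω = ∑ j : Fin Φ.n, inner ℝ (Φ.φ j ω)
      (stoppedValue X (Φ.τ j.succ) ω - stoppedValue X (Φ.τ j.castSucc) ω) := by
  rw [terminalWealth, zero_add]
  refine Finset.sum_congr rfl fun j _ => ?_
  rcases (Φ.monotone_τ ω j.castSucc_lt_succ.le).eq_or_lt with heq | hlt
  · have : stoppedValue X (Φ.τ j.succ) ω = stoppedValue X (Φ.τ j.castSucc) ω := by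
      simp only [stoppedValue]
      rw [← show Φ.τ j.castSucc ω = Φ.τ j.succ ω from heq]
    simp [this]
  · congr 1
    obtain ⟨t, ht⟩ := WithTop.ne_top_iff_exists.1 (hω j.succ).ne
    rw [stoppedValue_of_coe ht.symm, holding, Set.indicator_of_notMem, zero_add,
      Finset.sum_eq_single j]
    · exact Set.indicator_of_mem (by exact ⟨ht ▸ hlt, ht.le⟩) _
    · intro i _ hij
      refine Set.indicator_of_notMem ?_ _
      rintro ⟨h1, h2⟩
      rw [ht] at h1 h2
      rcases lt_or_gt_of_ne hij with h | h
      · have : i.succ ≤ j.castSucc := by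
          simp only [Fin.le_def, Fin.val_succ, Fin.val_castSucc]; exact h
        exact absurd (h2.trans (Φ.monotone_τ ω this)) (not_le.2 hlt)
      · have : j.succ ≤ i.castSucc := by
          simp only [Fin.le_def, Fin.val_succ, Fin.val_castSucc]; exact h
        exact absurd h1 (not_lt.2 (Φ.monotone_τ ω this))
    · simp
    · intro h0
      rw [Set.mem_singleton_iff.1 h0] at ht
      exact absurd (hlt.trans_eq ht.symm) (zero_le (α := WithTop ℝ≥0)).not_gt

/-- The strategy holding `φ` on `(σ, τ]`. -/
noncomputable def singleStep (hσ : IsStoppingTime 𝓕 σ) (hτ : IsStoppingTime 𝓕 τ) (hστ : σ ≤ τ)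
    (hσf : ∀ᵐ ω ∂P, σ ω < ⊤) (hτf : ∀ᵐ ω ∂P, τ ω < ⊤) (φ : Ω → EuclideanSpace ℝ (Fin D))
    (hφ : Measurable[hσ.measurableSpace] φ) : SimpleStrategy 𝓕 P D where
  -- Trading dates must begin at `0`, so an idle period `(0, σ]` comes first.
  n := 2
  n_pos := two_pos
  τ := ![fun _ => 0, σ, τ]
  φ := ![fun _ => 0, φ]
  isStoppingTime := fun j => match j with
    | 0 => isStoppingTime_const 𝓕 (0 : ℝ≥0)
    | 1 => hσ
    | 2 => hτ
  τ_zero _ := rfl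
  monotone_τ ω := by
    refine Fin.monotone_iff_le_succ.2 fun i => ?_
    fin_cases i
    · exact zero_le
    · exact hστ ω
  finite_τ := fun j => match j with
    | 0 => .of_forall fun _ => WithTop.coe_lt_top (0 : ℝ≥0)
    | 1 => hσf
    | 2 => hτf
  measurable_φ := fun j => match j with
    | 0 => measurable_const
    | 1 => hφ

theorem ae_terminalWealth_singleStep (hσ : IsStoppingTime 𝓕 σ) (hτ : IsStoppingTime 𝓕 τ)
    (hστ : σ ≤ τ) (hσf : ∀ᵐ ω ∂P, σ ω < ⊤) (hτf : ∀ᵐ ω ∂P, τ ω < ⊤)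
    (φ : Ω → EuclideanSpace ℝ (Fin D)) (hφ : Measurable[hσ.measurableSpace] φ) :
    ∀ᵐ ω ∂P, (singleStep hσ hτ hστ hσf hτf φ hφ).terminalWealth X 0 ω =
      inner ℝ (φ ω) (stoppedValue X τ ω - stoppedValue X σ ω) := by
  filter_upwards [ae_all_iff.2 (singleStep hσ hτ hστ hσf hτf φ hφ).finite_τ] with ω hω
  rw [SimpleStrategy.terminalWealth_eq_sum _ hω]
  change ∑ j : Fin 2, _ = _
  rw [Fin.sum_univ_two]
  simp [singleStep]

/-- The stopping time equal to `t` on `A ∈ 𝓕 t` and infinite elsewhere. -/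
theorem isStoppingTime_piecewise_top {t : ℝ≥0} {A : Set Ω} [DecidablePred (· ∈ A)]
    (hA : MeasurableSet[𝓕 t] A) :
    IsStoppingTime 𝓕 (fun ω => if ω ∈ A then (t : WithTop ℝ≥0) else ⊤) := by
  intro i
  by_cases hti : t ≤ i
  · convert! 𝓕.mono hti _ hA using 1
    ext ω
    by_cases h : ω ∈ A <;> simp [h, -ENNReal.some_eq_coe', hti]
  · convert! @MeasurableSet.empty _ (𝓕 i) using 1
    ext ω
    by_cases h : ω ∈ A <;> simp [h, -ENNReal.some_eq_coe', hti]

/-! ### From no simple arbitrage to NOA -/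

/-- On `σ ≤ q`, truncating `H` and replacing `σ` by `σ ∧ q` changes nothing and makes every
ingredient `𝓕 q`-measurable. -/
theorem measurableSet_gain (h𝓕 : UsualConditions 𝓕 P) (hX : Adapted 𝓕 X)
    (hrc : ∀ᵐ ω ∂P, ∀ t : ℝ≥0, ContinuousWithinAt (fun s => X s ω) (Set.Ici t) t)
    (hσ : IsStoppingTime 𝓕 σ) {H : Ω → EuclideanSpace ℝ (Fin D)}
    (hH : Measurable[hσ.measurableSpace] H) (q : ℝ≥0) {B : Set ℝ} (hB : MeasurableSet B) :
    MeasurableSet[𝓕 q] {ω | σ ω ≤ q ∧ inner ℝ (H ω) (X q ω - stoppedValue X σ ω) ∈ B} := by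
  have h1 : Measurable[𝓕 q] ({ω | σ ω ≤ q}.indicator H) :=
    (measurable_indicator_min_const hσ hH q).mono
      ((hσ.min_const q).measurableSpace_le_of_le_const fun _ => min_le_right _ _) le_rfl
  have h2 : Measurable[𝓕 q] (stoppedValue X fun ω => min (σ ω) q) :=
    measurable_stoppedValue_of_le h𝓕 hX hrc (hσ.min_const q) fun _ => min_le_right _ _
  have h3 : Measurable[𝓕 q] fun ω => (inner ℝ ({ω | σ ω ≤ q}.indicator H ω)
      (X q ω - stoppedValue X (fun ω => min (σ ω) q) ω) : ℝ) :=
    Measurable.inner h1 (Measurable.sub (hX q) h2)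
  convert! (hσ q).inter (h3 hB) using 1
  ext ω
  by_cases h : σ ω ≤ q
  · have h4 : stoppedValue X (fun ω => min (σ ω) q) ω = stoppedValue X σ ω := by
      rw [stoppedValue, stoppedValue, min_eq_left h]
    simp only [Set.mem_inter_iff, Set.mem_ofPred_eq, Set.mem_preimage, h4,
      Set.indicator_of_mem (s := {ω | σ ω ≤ q}) h]
  · simp only [Set.mem_inter_iff, Set.mem_ofPred_eq, h, false_and]

/-- Reduces conditions on uncountably many times of a right-continuous path to countably many. -/
theorem exists_denseSeq_gt {t : ℝ≥0} {p : ℝ≥0 → Prop} (h : ∀ᶠ u in 𝓝[≥] t, p u) :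
    ∃ k, t < TopologicalSpace.denseSeq ℝ≥0 k ∧ p (TopologicalSpace.denseSeq ℝ≥0 k) := by
  obtain ⟨δ, hδ, hsub⟩ := mem_nhdsGE_iff_exists_Ico_subset.1 h
  obtain ⟨k, hk⟩ := (TopologicalSpace.denseRange_denseSeq ℝ≥0).exists_mem_open isOpen_Ioo
    (Set.nonempty_Ioo.2 hδ)
  exact ⟨k, hk.1, hsub ⟨hk.1.le, hk.2⟩⟩

theorem continuousWithinAt_gain {E : Type*} [NormedAddCommGroup E] [InnerProductSpace ℝ E]
    {x : ℝ≥0 → E} (hx : ∀ t : ℝ≥0, ContinuousWithinAt x (Set.Ici t) t) (a y : E) (t : ℝ≥0) :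
    ContinuousWithinAt (fun s => (inner ℝ a (x s - y) : ℝ)) (Set.Ici t) t :=
  continuousWithinAt_const.inner (𝕜 := ℝ) ((hx t).sub continuousWithinAt_const)

theorem noObviousArbitrage_of_not_hasSimpleArbitrage (h𝓕 : UsualConditions 𝓕 P)
    (hX : Adapted 𝓕 X)
    (hrc : ∀ᵐ ω ∂P, ∀ t : ℝ≥0, ContinuousWithinAt (fun s => X s ω) (Set.Ici t) t)
    (hNA : ¬ HasSimpleArbitrage X 𝓕 P) : NoObviousArbitrage X 𝓕 P := by
  classical
  have := h𝓕.rightContinuous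
  intro σ hσ ε hε hfin H hH _
  by_contra hnull
  refine hNA ?_
  have hsup : ∀ᵐ ω ∂P, σ ω < ⊤ → (ε : EReal) ≤ ⨆ (t : ℝ≥0) (_ : σ ω ≤ t),
      ((inner ℝ (H ω) (X t ω - stoppedValue X σ ω) : ℝ) : EReal) := by
    refine measure_mono_null ?_ (nonpos_iff_eq_zero.1 (not_lt.1 hnull))
    intro ω hω
    simpa using hω
  obtain ⟨N, hN⟩ : ∃ N : ℕ, 0 < P {ω | σ ω ≤ (N : ℝ≥0)} := by
    by_contra! hcon
    refine hfin.ne' (measure_mono_null ?_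
      (measure_iUnion_null fun N => nonpos_iff_eq_zero.1 (hcon N)))
    intro ω hω
    obtain ⟨s, hs⟩ := WithTop.ne_top_iff_exists.1 (show σ ω < ⊤ from hω).ne
    obtain ⟨n, hn⟩ := exists_nat_ge s
    exact Set.mem_iUnion.2 ⟨n, by
      rw [Set.mem_ofPred_eq, ← hs]
      exact WithTop.coe_le_coe.2 hn⟩
  set S : Set Ω := {ω | σ ω ≤ (N : ℝ≥0)} with hS
  set q := TopologicalSpace.denseSeq ℝ≥0 with hq
  -- The bound by `min N (q k)` encodes `σ ≤ N` in a form known at time `q k`.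
  let A : ℕ → Set Ω := fun k => {ω | σ ω < q k} ∩ {ω | σ ω ≤ (min (N : ℝ≥0) (q k) : ℝ≥0)} ∩
    {ω | σ ω ≤ q k ∧ inner ℝ (H ω) (X (q k) ω - stoppedValue X σ ω) ∈ Set.Ioi (ε / 2)}
  have hA : ∀ k, MeasurableSet[𝓕 (q k)] (A k) := fun k =>
    ((hσ.measurableSet_lt _).inter (𝓕.mono (min_le_right _ _) _ (hσ _))).inter
      (measurableSet_gain h𝓕 hX hrc hσ hH (q k) measurableSet_Ioi)
  let U : Ω → WithTop ℝ≥0 := fun ω => ⨅ k, if ω ∈ A k then (q k : WithTop ℝ≥0) else ⊤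
  -- Off `S` no position is taken; `V` only makes the selling time finite there. The infimum `U` is
  -- a stopping time because the filtration is right-continuous.
  let V : Ω → WithTop ℝ≥0 := fun ω => if ω ∈ Sᶜ then ((N : ℝ≥0) : WithTop ℝ≥0) else ⊤
  have hτ : IsStoppingTime 𝓕 (fun ω => min (U ω) (V ω)) :=
    (IsStoppingTime.iInf fun k => isStoppingTime_piecewise_top (hA k)).min
      (isStoppingTime_piecewise_top (hσ _).compl)
  set τ : Ω → WithTop ℝ≥0 := fun ω => min (U ω) (V ω) with hτ_def
  have hστ : (fun ω => min (σ ω) (N : ℝ≥0)) ≤ τ := by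
    intro ω
    refine le_min (le_iInf fun k => ?_) ?_
    · split_ifs with h
      · exact (min_le_left _ _).trans h.1.1.le
      · exact le_top
    · simp only [V]
      split_ifs
      · exact min_le_right _ _
      · exact le_top
  have key : ∀ᵐ ω ∂P, τ ω < ⊤ ∧ (ω ∈ S →
      ε / 2 ≤ inner ℝ (H ω) (stoppedValue X τ ω - stoppedValue X σ ω)) := by
    filter_upwards [hrc, hsup] with ω hω hsupω
    by_cases hωS : ω ∈ S
    · obtain ⟨s, hs⟩ := WithTop.ne_top_iff_exists.1
        ((show σ ω ≤ (N : ℝ≥0) from hωS).trans_lt (WithTop.coe_lt_top _)).ne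
      have hsN : s ≤ N := WithTop.coe_le_coe.1 (hs ▸ hωS)
      specialize hsupω (hs ▸ WithTop.coe_lt_top s)
      rw [stoppedValue_of_coe hs.symm] at hsupω ⊢
      have hf := continuousWithinAt_gain hω (H ω) (X s ω)
      -- The supremum may equal `ε` without being attained; the lower level `ε / 2` is strictly
      -- exceeded at some time.
      have hlt : ((ε / 2 : ℝ) : EReal) < ε := EReal.coe_lt_coe_iff.2 (half_lt_self hε)
      obtain ⟨t, ht⟩ := lt_iSup_iff.1 (hlt.trans_le hsupω)
      obtain ⟨hst, ht⟩ := lt_iSup_iff.1 ht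
      rw [← hs, WithTop.coe_le_coe] at hst
      rw [EReal.coe_lt_coe_iff] at ht
      have hmem : ∀ k, ω ∈ A k ↔ s < q k ∧ s ≤ min (N : ℝ≥0) (q k) ∧ s ≤ q k ∧
          ε / 2 < inner ℝ (H ω) (X (q k) ω - X s ω) := by
        intro k
        simp only [A, Set.mem_inter_iff, Set.mem_ofPred_eq, ← hs, stoppedValue_of_coe hs.symm,
          WithTop.coe_lt_coe, WithTop.coe_le_coe, Set.mem_Ioi, and_assoc]
      have hV : V ω = ⊤ := if_neg (not_not.2 hωS)
      have hτU : τ ω = U ω := by rw [hτ_def]; simp [hV]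
      have hτfin : τ ω < ⊤ := by
        obtain ⟨k, hk, hk'⟩ := exists_denseSeq_gt ((hf t).eventually (lt_mem_nhds ht))
        have hsk := hst.trans_lt hk
        have : ω ∈ A k := (hmem k).2 ⟨hsk, le_min hsN hsk.le, hsk.le, hk'⟩
        rw [hτU]
        refine (iInf_le _ k).trans_lt ?_
        rw [if_pos this]
        exact WithTop.coe_lt_top _
      refine ⟨hτfin, fun _ => ?_⟩
      obtain ⟨r, hr⟩ := WithTop.ne_top_iff_exists.1 hτfin.ne
      rw [stoppedValue_of_coe hr.symm]
      -- A gain below `ε / 2` at `r` would persist on some `[r, δ)`, yet the infimum `r` forces a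
      -- dense time in that interval with gain above `ε / 2`.
      by_contra! hcon
      obtain ⟨δ, hδ, hsub⟩ := mem_nhdsGE_iff_exists_Ico_subset.1
        ((hf r).eventually (gt_mem_nhds hcon))
      have hUδ : U ω < δ := by
        rw [← hτU, ← hr]
        exact WithTop.coe_lt_coe.2 hδ
      obtain ⟨k, hk⟩ := iInf_lt_iff.1 hUδ
      by_cases hkA : ω ∈ A k
      · rw [if_pos hkA] at hk
        have hrk : r ≤ q k := by
          rw [← WithTop.coe_le_coe, hr, hτU]
          refine (iInf_le _ k).trans ?_
          rw [if_pos hkA]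
        exact absurd ((hmem k).1 hkA).2.2.2
          (not_lt.2 (le_of_lt (hsub ⟨hrk, WithTop.coe_lt_coe.1 hk⟩)))
      · rw [if_neg hkA] at hk
        exact absurd hk not_top_lt
    · refine ⟨(min_le_right _ _).trans_lt ?_, fun h => absurd h hωS⟩
      simp only [V, if_pos (show ω ∈ Sᶜ from hωS)]
      exact WithTop.coe_lt_top _
  have hσf : ∀ᵐ ω ∂P, min (σ ω) ((N : ℝ≥0) : WithTop ℝ≥0) < ⊤ :=
    .of_forall fun ω => (min_le_right _ _).trans_lt (WithTop.coe_lt_top _)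
  have hφ := measurable_indicator_min_const hσ hH (N : ℝ≥0)
  have hτf := key.mono fun _ h => h.1
  have hval : ∀ᵐ ω ∂P, 0 ≤ (singleStep (hσ.min_const _) hτ hστ hσf hτf _ hφ).terminalWealth X 0 ω ∧
      (ω ∈ S → 0 < (singleStep (hσ.min_const _) hτ hστ hσf hτf _ hφ).terminalWealth X 0 ω) := by
    filter_upwards [ae_terminalWealth_singleStep (X := X) (hσ.min_const _) hτ hστ hσf hτf _ hφ,
      key] with ω hω hkey
    rw [hω]
    by_cases hωS : ω ∈ S
    · have h1 : stoppedValue X (fun ω => min (σ ω) (N : ℝ≥0)) ω = stoppedValue X σ ω := by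
        rw [stoppedValue, stoppedValue, min_eq_left (show σ ω ≤ (N : ℝ≥0) from hωS)]
      rw [h1, Set.indicator_of_mem hωS]
      have := hkey.2 hωS
      exact ⟨by linarith, fun _ => by linarith⟩
    · rw [Set.indicator_of_notMem hωS]
      simp [hωS]
  refine ⟨singleStep (hσ.min_const _) hτ hστ hσf hτf _ hφ, hval.mono fun _ h => h.1,
    hN.trans_le (measure_mono_ae (hval.mono fun _ h => h.2))⟩

/-! ### From NOA to no simple arbitrage -/

/-- An arbitrage strategy has a step that is an arbitrage when it is used only on the event that
the wealth accumulated before is nonpositive. -/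
theorem SimpleStrategy.IsArbitrage.exists_singleStep (h𝓕 : UsualConditions 𝓕 P)
    (hX : Adapted 𝓕 X)
    (hrc : ∀ᵐ ω ∂P, ∀ t : ℝ≥0, ContinuousWithinAt (fun s => X s ω) (Set.Ici t) t)
    {Φ : SimpleStrategy 𝓕 P D} (hΦ : Φ.IsArbitrage X) :
    ∃ (σ τ : Ω → WithTop ℝ≥0) (hσ : IsStoppingTime 𝓕 σ) (φ : Ω → EuclideanSpace ℝ (Fin D)),
      IsStoppingTime 𝓕 τ ∧ σ ≤ τ ∧ (∀ᵐ ω ∂P, τ ω < ⊤) ∧ Measurable[hσ.measurableSpace] φ ∧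
      (∀ᵐ ω ∂P, 0 ≤ inner ℝ (φ ω) (stoppedValue X τ ω - stoppedValue X σ ω)) ∧
      0 < P {ω | 0 < inner ℝ (φ ω) (stoppedValue X τ ω - stoppedValue X σ ω)} := by
  classical
  let g : Fin Φ.n → Ω → ℝ := fun j ω => inner ℝ (Φ.φ j ω)
    (stoppedValue X (Φ.τ j.succ) ω - stoppedValue X (Φ.τ j.castSucc) ω)
  let V : ℕ → Ω → ℝ := fun k ω => ∑ j : Fin Φ.n, if j.val < k then g j ω else 0
  have hV0 : ∀ ω, V 0 ω = 0 := by simp [V]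
  have hVs : ∀ (j : Fin Φ.n) ω, V (j + 1) ω = V j ω + g j ω := by
    intro j ω
    have : g j ω = ∑ i : Fin Φ.n, if i = j then g i ω else 0 := by simp
    rw [this]
    simp only [V, ← Finset.sum_add_distrib]
    refine Finset.sum_congr rfl fun i _ => ?_
    rcases lt_trichotomy i.val j.val with h | h | h
    · simp [h, h.trans (Nat.lt_succ_self _), Fin.ne_of_lt h]
    · obtain rfl := Fin.ext h
      simp
    · simp [not_lt.2 h.le, not_lt.2 (Nat.succ_le_of_lt h), (Fin.ne_of_lt h).symm]
  have hVn : ∀ᵐ ω ∂P, Φ.terminalWealth X 0 ω = V Φ.n ω := by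
    filter_upwards [ae_all_iff.2 Φ.finite_τ] with ω hω
    rw [Φ.terminalWealth_eq_sum hω]
    exact Finset.sum_congr rfl fun j _ => (if_pos j.isLt).symm
  let IsArb : ℕ → Prop := fun k => (∀ᵐ ω ∂P, 0 ≤ V k ω) ∧ 0 < P {ω | 0 < V k ω}
  have hn : IsArb Φ.n := by
    refine ⟨?_, hΦ.2.trans_le (measure_mono_ae ?_)⟩
    · filter_upwards [hVn, hΦ.1] with ω h1 h2 using h1 ▸ h2
    · filter_upwards [hVn] with ω h1 h2
      exact lt_of_lt_of_eq h2 h1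
  have h0 : ¬ IsArb 0 := fun h => by simpa [hV0] using h.2
  -- A period at which the accumulated wealth turns into an arbitrage.
  obtain ⟨k, hk, hmin⟩ : ∃ k : Fin Φ.n, IsArb (k + 1) ∧ ¬ IsArb k := by
    by_contra! hcon
    have : ∀ m ≤ Φ.n, ¬ IsArb m := by
      intro m
      induction m with
      | zero => exact fun _ => h0
      | succ m ih => exact fun hm h => ih (Nat.le_of_succ_le hm) (hcon ⟨m, hm⟩ h)
    exact this _ le_rfl hn
  have hσ := Φ.isStoppingTime k.castSucc
  have hVm : Measurable[hσ.measurableSpace] (V k) := by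
    refine Finset.measurable_fun_sum _ fun j _ => ?_
    split_ifs with hjk
    · have hs := Φ.isStoppingTime j.succ
      have hc := Φ.isStoppingTime j.castSucc
      have hs' : Φ.τ j.succ ≤ Φ.τ k.castSucc := fun ω => Φ.monotone_τ ω (by
        simp only [Fin.le_def, Fin.val_succ, Fin.val_castSucc]; exact hjk)
      have hc' : Φ.τ j.castSucc ≤ Φ.τ k.castSucc := fun ω => Φ.monotone_τ ω (by
        simp only [Fin.le_def, Fin.val_castSucc]; exact hjk.le)
      exact Measurable.inner
        ((Φ.measurable_φ j).mono (hc.measurableSpace_mono hσ hc') le_rfl)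
        (Measurable.sub ((measurable_stoppedValue_stoppingTime h𝓕 hX hrc hs).mono
            (hs.measurableSpace_mono hσ hs') le_rfl)
          ((measurable_stoppedValue_stoppingTime h𝓕 hX hrc hc).mono
            (hc.measurableSpace_mono hσ hc') le_rfl))
    · exact measurable_const
  have hval : ∀ ω, inner ℝ ({ω | V k ω ≤ 0}.indicator (Φ.φ k) ω)
      (stoppedValue X (Φ.τ k.succ) ω - stoppedValue X (Φ.τ k.castSucc) ω) =
      if V k ω ≤ 0 then V (k + 1) ω - V k ω else 0 := by
    intro ω
    split_ifs with h
    · rw [Set.indicator_of_mem (by exact h), hVs, add_sub_cancel_left]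
    · rw [Set.indicator_of_notMem (by exact h), inner_zero_left]
  refine ⟨Φ.τ k.castSucc, Φ.τ k.succ, hσ, {ω | V k ω ≤ 0}.indicator (Φ.φ k),
    Φ.isStoppingTime _, fun ω => Φ.monotone_τ ω k.castSucc_lt_succ.le, Φ.finite_τ _,
    (Φ.measurable_φ k).indicator (hVm measurableSet_Iic), ?_, ?_⟩
  · filter_upwards [hk.1] with ω hω
    rw [hval]
    split_ifs <;> linarith
  · simp only [hval]
    -- Either `V k` vanishes a.s. and the step gains all of `V (k + 1)`, or `V k < 0` with positive
    -- probability and the step must recover that debt.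
    by_cases hnn : ∀ᵐ ω ∂P, 0 ≤ V k ω
    · have hz : ∀ᵐ ω ∂P, V k ω ≤ 0 := by
        have h1 : P {ω | 0 < V k ω} = 0 :=
          nonpos_iff_eq_zero.1 (not_lt.1 fun h => hmin ⟨hnn, h⟩)
        filter_upwards [measure_eq_zero_iff_ae_notMem.1 h1] with ω hω using not_lt.1 hω
      refine hk.2.trans_le (measure_mono_ae ?_)
      filter_upwards [hz] with ω h1 (h2 : 0 < V (k + 1) ω)
      change 0 < if V k ω ≤ 0 then V (k + 1) ω - V k ω else 0
      rw [if_pos h1]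
      linarith
    · have hneg : 0 < P {ω | V k ω < 0} := by
        refine pos_iff_ne_zero.2 fun h => hnn ?_
        filter_upwards [measure_eq_zero_iff_ae_notMem.1 h] with ω hω using not_lt.1 hω
      refine hneg.trans_le (measure_mono_ae ?_)
      filter_upwards [hk.1] with ω h1 (h2 : V k ω < 0)
      change 0 < if V k ω ≤ 0 then V (k + 1) ω - V k ω else 0
      rw [if_pos h2.le]
      linarith

/-- The gains of a buy-and-hold position in a local martingale vanish if they are nonnegative
throughout the holding period. -/
theorem IsLocalMartingale.gain_eq_zero [IsProbabilityMeasure P]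
    (hloc : IsLocalMartingale X 𝓕 P)
    (hrc : ∀ᵐ ω ∂P, ∀ t : ℝ≥0, ContinuousWithinAt (fun s => X s ω) (Set.Ici t) t)
    (hσ : IsStoppingTime 𝓕 σ) (hτ : IsStoppingTime 𝓕 τ) (hστ : σ ≤ τ)
    (hτf : ∀ᵐ ω ∂P, τ ω < ⊤) {φ : Ω → EuclideanSpace ℝ (Fin D)}
    (hφ : Measurable[hσ.measurableSpace] φ)
    (hnn : ∀ᵐ ω ∂P, ∀ s : ℝ≥0, σ ω ≤ s → s ≤ τ ω →
      0 ≤ inner ℝ (φ ω) (X s ω - stoppedValue X σ ω)) :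
    ∀ᵐ ω ∂P, inner ℝ (φ ω) (stoppedValue X τ ω - stoppedValue X σ ω) = 0 := by
  obtain ⟨ρ, hρ, hM⟩ := hloc
  -- A positive rescaling bounds the position, as optional sampling needs, and preserves signs and
  -- zeros of gains.
  set G : Ω → EuclideanSpace ℝ (Fin D) := fun ω => (1 + ‖φ ω‖)⁻¹ • φ ω with hG
  have hc : ∀ ω, 0 < (1 + ‖φ ω‖)⁻¹ := fun ω => by positivity
  have hGm : Measurable[hσ.measurableSpace] G :=
    (by fun_prop : Measurable fun v : EuclideanSpace ℝ (Fin D) => (1 + ‖v‖)⁻¹ • v).comp hφ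
  have hG1 : ∀ ω, ‖G ω‖ ≤ 1 := by
    intro ω
    rw [hG, norm_smul, Real.norm_of_nonneg (hc ω).le, inv_mul_le_one₀ (by positivity)]
    linarith [norm_nonneg (φ ω)]
  obtain ⟨S, hS⟩ : ∃ S : ℕ → Set Ω, ∀ n, S n = {ω | ⊥ < ρ n ω} := ⟨_, fun _ => rfl⟩
  simp only [← hS] at hM
  obtain ⟨T, hT⟩ : ∃ T : ℕ → Set Ω, ∀ k, T k = {ω | σ ω ≤ (k : ℝ≥0)} := ⟨_, fun _ => rfl⟩
  have hGT : ∀ k : ℕ, Measurable[(hσ.min_const (k : ℝ≥0)).measurableSpace] ((T k).indicator G) :=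
    fun k => hT k ▸ measurable_indicator_min_const hσ hGm (k : ℝ≥0)
  let Y : ℕ → ℝ≥0 → Ω → EuclideanSpace ℝ (Fin D) := fun n i => (S n).indicator (X i)
  have hval : ∀ (n : ℕ) (k : ℝ≥0) (κ : Ω → WithTop ℝ≥0) (ω : Ω),
      stoppedValue (stoppedProcess (Y n) (ρ n)) (fun ω => min (κ ω) k) ω =
        (S n).indicator
          (stoppedValue X (fun ω => min (min (κ ω) k) (ρ n ω))) ω := by
    intro n k κ ω
    rw [stoppedValue_stoppedProcess_apply (σ := fun ω => min (κ ω) k)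
      ((min_le_right _ _).trans_lt (WithTop.coe_lt_top _)).ne]
    by_cases h : ω ∈ S n <;> simp only [Y, stoppedValue, Set.indicator, h, if_true, if_false]
  have key : ∀ n k : ℕ, ∀ᵐ ω ∂P, inner ℝ ((T k).indicator G ω)
      (stoppedValue (stoppedProcess (Y n) (ρ n)) (fun ω => min (τ ω) (k : ℝ≥0)) ω
        - stoppedValue (stoppedProcess (Y n) (ρ n)) (fun ω => min (σ ω) (k : ℝ≥0)) ω) = 0 := by
    intro n k
    have hMrc : ∀ᵐ ω ∂P, ∀ t : ℝ≥0,
        ContinuousWithinAt (fun s => stoppedProcess (Y n) (ρ n) s ω) (Set.Ici t) t := by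
      filter_upwards [hrc] with ω hω
      refine continuousWithinAt_stoppedProcess fun t => ?_
      by_cases h : ω ∈ S n
      · simpa only [Y, Set.indicator_of_mem h] using hω t
      · simpa only [Y, Set.indicator_of_notMem h] using continuousWithinAt_const
    obtain ⟨hint, hzero⟩ := integral_inner_stoppedValue_sub (hM n) hMrc
      (hσ.min_const (k : ℝ≥0)) (hτ.min_const (k : ℝ≥0))
      (fun ω => min_le_min_right _ (hστ ω)) (fun ω => min_le_right _ _)
      (hGT k)
      (fun ω => (norm_indicator_le_norm_self _ _).trans (hG1 ω))
    refine (integral_eq_zero_iff_of_nonneg_ae ?_ hint).1 hzero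
    filter_upwards [hnn] with ω hω
    change 0 ≤ inner ℝ _ (stoppedValue (stoppedProcess (Y n) (ρ n)) _ ω -
      stoppedValue (stoppedProcess (Y n) (ρ n)) _ ω)
    rw [hval, hval]
    by_cases hωT : ω ∈ T k
    · have hσk : σ ω ≤ (k : ℝ≥0) := by
        rw [hT] at hωT
        exact hωT
      simp only [Set.indicator_of_mem hωT]
      by_cases hpos : ω ∈ S n
      · simp only [Set.indicator_of_mem hpos]
        -- If `ρ n ≤ σ`, both stopped values are taken at `ρ n` and the gain is zero; otherwise the
        -- final time lies in `[σ, τ]`, where `hnn` applies.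
        rcases le_total (ρ n ω) (σ ω) with h | h
        · have h1 : min (min (τ ω) (k : ℝ≥0)) (ρ n ω) = ρ n ω :=
            min_eq_right (le_min (h.trans (hστ ω)) (h.trans hσk))
          have h2 : min (min (σ ω) (k : ℝ≥0)) (ρ n ω) = ρ n ω :=
            min_eq_right (le_min h (h.trans hσk))
          simp only [stoppedValue, h1, h2, sub_self, inner_zero_right, le_refl]
        · have h2 : min (min (σ ω) (k : ℝ≥0)) (ρ n ω) = σ ω := by
            rw [min_eq_left hσk, min_eq_left h]
          have h3 : stoppedValue X (fun ω => min (min (σ ω) (k : ℝ≥0)) (ρ n ω)) ω =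
              stoppedValue X σ ω := by
            simp only [stoppedValue, h2]
          obtain ⟨u, hu⟩ := WithTop.ne_top_iff_exists.1 (((min_le_left _ (ρ n ω)).trans
            (min_le_right (τ ω) _)).trans_lt (WithTop.coe_lt_top (k : ℝ≥0))).ne
          rw [h3, stoppedValue_of_coe
            (τ := fun ω => min (min (τ ω) (k : ℝ≥0)) (ρ n ω)) hu.symm, hG, real_inner_smul_left]
          refine mul_nonneg (hc ω).le (hω u ?_ ?_)
          · rw [hu]
            exact le_min (le_min (hστ ω) hσk) h
          · rw [hu]
            exact (min_le_left _ _).trans (min_le_left _ _)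
      · simp only [Set.indicator_of_notMem hpos, sub_self, inner_zero_right, le_refl]
    · simp only [Set.indicator_of_notMem hωT, inner_zero_left, le_refl]
  filter_upwards [ae_all_iff.2 fun n => ae_all_iff.2 (key n), hρ.tendsto_top, hτf]
    with ω hω hρω hτω
  obtain ⟨r, hr⟩ := WithTop.ne_top_iff_exists.1 hτω.ne
  obtain ⟨k, hk⟩ := exists_nat_ge r
  -- Once `k ≥ τ` and `ρ n > τ`, the truncations disappear at this `ω`.
  obtain ⟨n, hn⟩ := (hρω.eventually (lt_mem_nhds hτω)).exists
  have hτk : τ ω ≤ (k : ℝ≥0) := hr ▸ WithTop.coe_le_coe.2 hk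
  have hσk : σ ω ≤ (k : ℝ≥0) := (hστ ω).trans hτk
  have h := hω n k
  have hpos : ω ∈ S n := by
    rw [hS]
    exact bot_le.trans_lt hn
  have hωT : ω ∈ T k := by
    rw [hT]
    exact hσk
  rw [hval, hval] at h
  simp only [Set.indicator_of_mem hpos, Set.indicator_of_mem hωT] at h
  rw [hG, real_inner_smul_left] at h
  simp only [stoppedValue, min_eq_left hτk, min_eq_left hσk, min_eq_left hn.le,
    min_eq_left ((hστ ω).trans hn.le)] at h
  exact (mul_eq_zero.1 h).resolve_left (hc ω).ne'

/-- Without obvious arbitrage, a buy-and-hold position with nonnegative final gain has nonnegative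
gains throughout the holding period. -/
theorem NoObviousArbitrage.gain_nonneg (hNOA : NoObviousArbitrage X 𝓕 P)
    (h𝓕 : UsualConditions 𝓕 P) (hX : Adapted 𝓕 X)
    (hrc : ∀ᵐ ω ∂P, ∀ t : ℝ≥0, ContinuousWithinAt (fun s => X s ω) (Set.Ici t) t)
    (hσ : IsStoppingTime 𝓕 σ) (hτ : IsStoppingTime 𝓕 τ)
    (hτf : ∀ᵐ ω ∂P, τ ω < ⊤) {φ : Ω → EuclideanSpace ℝ (Fin D)}
    (hφ : Measurable[hσ.measurableSpace] φ)
    (hfinal : ∀ᵐ ω ∂P, 0 ≤ inner ℝ (φ ω) (stoppedValue X τ ω - stoppedValue X σ ω)) :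
    ∀ᵐ ω ∂P, ∀ s : ℝ≥0, σ ω ≤ s → s ≤ τ ω →
      0 ≤ inner ℝ (φ ω) (X s ω - stoppedValue X σ ω) := by
  classical
  -- Where `φ = 0` this gives `H = 0`; such points never enter the loss events `B` below.
  set H : Ω → EuclideanSpace ℝ (Fin D) := fun ω => ‖φ ω‖⁻¹ • φ ω with hH
  have hHm : Measurable[hσ.measurableSpace] H :=
    (by fun_prop : Measurable fun v : EuclideanSpace ℝ (Fin D) => ‖v‖⁻¹ • v).comp hφ
  have hinner : ∀ ω y, (inner ℝ (H ω) y : ℝ) = ‖φ ω‖⁻¹ * inner ℝ (φ ω) y := fun ω y =>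
    real_inner_smul_left _ _ _
  have hnorm : ∀ ω, φ ω ≠ 0 → ‖H ω‖ = 1 := fun ω h => by
    rw [hH, norm_smul, norm_inv, norm_norm, inv_mul_cancel₀ (norm_ne_zero_iff.2 h)]
  set q := TopologicalSpace.denseSeq ℝ≥0 with hq
  have key : ∀ k m : ℕ, P ({ω | σ ω ≤ q k ∧ inner ℝ (H ω) (X (q k) ω - stoppedValue X σ ω) ∈
      Set.Iio (-(1 / ((m : ℝ) + 1)))} ∩ {ω | q k < τ ω}) = 0 := by
    intro k m
    set B := {ω | σ ω ≤ q k ∧ inner ℝ (H ω) (X (q k) ω - stoppedValue X σ ω) ∈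
      Set.Iio (-(1 / ((m : ℝ) + 1)))} ∩ {ω | q k < τ ω} with hB
    have hBm : MeasurableSet[𝓕 (q k)] B :=
      (measurableSet_gain h𝓕 hX hrc hσ hHm (q k) measurableSet_Iio).inter
        (hτ.measurableSet_gt (q k))
    have hm : (0 : ℝ) < 1 / ((m : ℝ) + 1) := by positivity
    have hBφ : ∀ ω ∈ B, φ ω ≠ 0 := by
      intro ω hω h0
      have h1 := hω.1.2
      rw [hinner, h0, inner_zero_left, mul_zero, Set.mem_Iio] at h1
      linarith
    by_contra hpos
    obtain ⟨ω₀, hω₀⟩ := nonempty_of_measure_ne_zero hpos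
    -- NOA is applied to entry at `q k` on `B` and never elsewhere: on `B`, climbing from below `-1
    -- / (m + 1)` to a nonnegative gain at `τ` earns more than `1 / (m + 1)`.
    have hσ' := isStoppingTime_piecewise_top hBm
    have hle : 𝓕 (q k) ≤ hσ'.measurableSpace := hσ'.le_measurableSpace_of_const_le fun ω => by
      split_ifs
      · exact le_rfl
      · exact le_top
    have h1 : Measurable[𝓕 (q k)] ({ω | σ ω ≤ q k}.indicator H) :=
      (measurable_indicator_min_const hσ hHm (q k)).mono
        ((hσ.min_const (q k)).measurableSpace_le_of_le_const fun _ => min_le_right _ _) le_rfl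
    -- NOA needs a unit vector off `B` too; the value of `H` at a point of `B` supplies one, also
    -- covering `D = 0`, where `B` would be empty.
    have hH' : Measurable[hσ'.measurableSpace]
        (B.piecewise ({ω | σ ω ≤ q k}.indicator H) fun _ => H ω₀) :=
      (Measurable.piecewise hBm h1 measurable_const).mono hle le_rfl
    have hH'B : ∀ ω ∈ B, B.piecewise ({ω | σ ω ≤ q k}.indicator H) (fun _ => H ω₀) ω = H ω := by
      intro ω hω
      rw [Set.piecewise_eq_of_mem _ _ _ hω, Set.indicator_of_mem (by exact hω.1.1)]
    have hfin : {ω | (if ω ∈ B then (q k : WithTop ℝ≥0) else ⊤) < ⊤} = B := by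
      ext ω
      by_cases h : ω ∈ B
      · simp only [Set.mem_ofPred_eq, h, if_true, iff_true]
        exact WithTop.coe_lt_top _
      · simp only [Set.mem_ofPred_eq, h, if_false, lt_irrefl]
    have hNOA' := hNOA _ hσ' (1 / ((m : ℝ) + 1)) hm (by rw [hfin]; exact pos_iff_ne_zero.2 hpos)
      _ hH' (.of_forall fun ω => ?_)
    · refine hNOA'.ne' ?_
      rw [hfin, measure_eq_zero_iff_ae_notMem]
      filter_upwards [hτf, hfinal] with ω hτω hfω
      rintro ⟨hω, hsup⟩
      rw [Set.mem_ofPred_eq, hH'B ω hω] at hsup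
      obtain ⟨r, hr⟩ := WithTop.ne_top_iff_exists.1 hτω.ne
      have hqr : q k < r := by
        rw [← WithTop.coe_lt_coe, hr]
        exact hω.2
      have h2 := (le_iSup₂_of_le r (by
        rw [if_pos hω]
        exact WithTop.coe_le_coe.2 hqr.le) le_rfl).trans_lt hsup
      rw [EReal.coe_lt_coe_iff,
        stoppedValue_of_coe (τ := fun ω => if ω ∈ B then (q k : WithTop ℝ≥0) else ⊤)
          (if_pos hω)] at h2
      rw [stoppedValue_of_coe hr.symm] at hfω
      have h3 : 0 ≤ inner ℝ (H ω) (X r ω - stoppedValue X σ ω) := by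
        rw [hinner]
        exact mul_nonneg (by positivity) hfω
      have h4 : inner ℝ (H ω) (X (q k) ω - stoppedValue X σ ω) < -(1 / ((m : ℝ) + 1)) := hω.1.2
      have h5 : X r ω - X (q k) ω =
        (X r ω - stoppedValue X σ ω) - (X (q k) ω - stoppedValue X σ ω) := by abel
      rw [h5, inner_sub_right] at h2
      linarith
    · by_cases hω : ω ∈ B
      · rw [hH'B ω hω]
        exact hnorm ω (hBφ ω hω)
      · rw [Set.piecewise_eq_of_notMem _ _ _ hω]
        exact hnorm ω₀ (hBφ ω₀ hω₀)
  filter_upwards [ae_all_iff.2 fun k => ae_all_iff.2 fun m =>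
    measure_eq_zero_iff_ae_notMem.1 (key k m), hrc, hτf, hfinal] with ω hω hrcω hτω hfω s hσs hsτ
  rcases hsτ.eq_or_lt with h | h
  · rwa [stoppedValue_of_coe h.symm] at hfω
  by_contra! hneg
  have hφ0 : φ ω ≠ 0 := fun h0 => by simp [h0] at hneg
  have hneg' : 0 < -(inner ℝ (H ω) (X s ω - stoppedValue X σ ω) : ℝ) := by
    rw [hinner, neg_pos]
    exact mul_neg_of_pos_of_neg (inv_pos.2 (norm_pos_iff.2 hφ0)) hneg
  obtain ⟨m, hm⟩ := exists_nat_one_div_lt hneg'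
  obtain ⟨r, hr⟩ := WithTop.ne_top_iff_exists.1 hτω.ne
  rw [← hr, WithTop.coe_lt_coe] at h
  -- A loss at `s < τ` persists just after `s`, hence at a dense time before `τ`, which the null
  -- events exclude.
  have h1 := ((continuousWithinAt_gain hrcω (H ω) (stoppedValue X σ ω) s).eventually
    (gt_mem_nhds (lt_neg.1 hm))).and (mem_nhdsWithin_of_mem_nhds (gt_mem_nhds h))
  obtain ⟨k, hk, hk1, hk2⟩ := exists_denseSeq_gt h1
  exact hω k m ⟨⟨hσs.trans (WithTop.coe_le_coe.2 hk.le), hk1⟩, (WithTop.coe_lt_coe.2 hk2).trans_eq hr⟩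

end

end SimpleArbitrage

theorem mainTheorem8 {Ω : Type*} [mΩ : MeasurableSpace Ω] (P : Measure Ω) [IsProbabilityMeasure P]
    (𝓕 : Filtration ℝ≥0 mΩ) (h𝓕 : SimpleArbitrage.UsualConditions 𝓕 P)
    (D : ℕ) (X : ℝ≥0 → Ω → EuclideanSpace ℝ (Fin D)) (hX_adapted : Adapted 𝓕 X)
    (hX_rightCont : ∀ᵐ ω ∂P, ∀ t : ℝ≥0, ContinuousWithinAt (fun s => X s ω) (Set.Ici t) t)
    (hX_localMartingale : ∃ Q : Measure Ω, IsProbabilityMeasure Q ∧ Q ≪ P ∧ P ≪ Q ∧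
      SimpleArbitrage.IsLocalMartingale X 𝓕 Q) :
    ¬ SimpleArbitrage.HasSimpleArbitrage X 𝓕 P ↔ SimpleArbitrage.NoObviousArbitrage X 𝓕 P := by
  refine ⟨SimpleArbitrage.noObviousArbitrage_of_not_hasSimpleArbitrage h𝓕 hX_adapted hX_rightCont,
    ?_⟩
  rintro hNOA ⟨Φ, hΦ⟩
  obtain ⟨Q, _, hQP, hPQ, hloc⟩ := hX_localMartingale
  obtain ⟨σ, τ, hσ, φ, hτ, hστ, hτf, hφ, hnn, hpos⟩ :=
    hΦ.exists_singleStep h𝓕 hX_adapted hX_rightCont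
  have h := hPQ.ae_le (hloc.gain_eq_zero (hQP.ae_le hX_rightCont) hσ hτ hστ (hQP.ae_le hτf) hφ
    (hQP.ae_le (hNOA.gain_nonneg h𝓕 hX_adapted hX_rightCont hσ hτ hτf hφ hnn)))
  refine hpos.ne' (measure_eq_zero_iff_ae_notMem.2 ?_)
  filter_upwards [h] with ω hω
  exact hω.le.not_gt
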